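/- Let $\Bbbk$ be an algebraically closed field of characteristic $0$, and let $\mathcal{C}$ be a multifusion category over $\Bbbk$: an abelian, $\Bbbk$-linear monoidal, rigid, semisimple category with finite-dimensional Hom-spaces, all objects of finite length, enough projectives and finitely many isomorphism classes of simple objects. Let $A$ be an algebra in $\mathcal{C}$. Write $\mathsf{Mod}\text{-}A(\mathcal{C})$ (resp. $A\text{-}\mathsf{Mod}(\mathcal{C})$) for the category of right (resp. left) $A$-modules in $\mathcal{C}$, regarded as a left (resp. right) $\mathcal{C}$-module category via $X\triangleright M=X\otimes M$ (resp. $N\triangleleft X=N\otimes X$). For $M\in\mathsf{Mod}\text{-}A(\mathcal{C})$ let $\underline{\mathrm{Hom}}(M,-)$ be the right adjoint of $(-\otimes M):\mathcal{C}\to\mathsf{Mod}\text{-}A(\mathcal{C})$, and let $\underline{\mathrm{End}}_{\mathsf{Mod}\text{-}A(\mathcal{C})}(M)=\underline{\mathrm{Hom}}(M,M)$ be the internal End, with its algebra structure in $\mathcal{C}$ induced by evaluation; for $N\in A\text{-}\mathsf{Mod}(\mathcal{C})$ define $\underline{\mathrm{End}}_{A\text{-}\mathsf{Mod}(\mathcal{C})}(N)$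 likewise from the right adjoint of $(N\otimes -):\mathcal{C}\to A\text{-}\mathsf{Mod}(\mathcal{C})$. A non-zero algebra is a right (resp. left) simplistic division algebra if its regular right (resp. left) module is simple. A module category is indecomposable if it is not the direct sum of two non-zero module subcategories. (i) If $\mathsf{Mod}\text{-}A(\mathcal{C})$ is semisimple, non-zero and indecomposable as a left $\mathcal{C}$-module category, then for every right $A$-module $M$ in $\mathcal{C}$, $\underline{\mathrm{End}}_{\mathsf{Mod}\text{-}A(\mathcal{C})}(M)$ is a right simplistic division algebra if and only if $M$ is simple in $\mathsf{Mod}\text{-}A(\mathcal{C})$. (ii) If $A\text{-}\mathsf{Mod}(\mathcal{C})$ is semisimple, non-zero and indecomposable as a right $\mathcal{C}$-module category, then for every left $A$-module $N$ in $\mathcal{C}$, $\underline{\mathrm{End}}_{A\text{-}\mathsf{Mod}(\mathcal{C})}(N)$ is a left simplistic division algebra if and only if $N$ is simple in $A\text{-}\mathsf{Mod}(\mathcal{C})$. -/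

import Mathlib

open CategoryTheory CategoryTheory.Limits MonoidalCategory

universe w v v₂ u u₂

namespace DivAlg

/-! ### Right and left modules over an algebra

Algebras in a monoidal category are Mathlib's `MonObj`, and left modules are Mathlib's `Mod C A`. -/

section RightModules

variable {C : Type u} [Category.{v} C] [MonoidalCategory C]

/-- A right module `(X, act)` over the algebra `A` in `C`. -/
structure RightMod (A : C) [MonObj A] where
  X : C
  act : X ⊗ A ⟶ X
  act_one : X ◁ (MonObj.one : 𝟙_ C ⟶ A) ≫ act = (ρ_ X).hom
  act_mul : X ◁ (MonObj.mul : A ⊗ A ⟶ A) ≫ act = (α_ X A A).inv ≫ act ▷ A ≫ act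

namespace RightMod

variable {A : C} [MonObj A]

/-- Morphisms of right `A`-modules. -/
@[ext]
structure Hom (M N : RightMod A) where
  hom : M.X ⟶ N.X
  act_hom : M.act ≫ hom = hom ▷ A ≫ N.act

instance : Category (RightMod A) where
  Hom M N := Hom M N
  id M := ⟨𝟙 M.X, by simp⟩
  comp f g := ⟨f.hom ≫ g.hom, by
    rw [← Category.assoc, f.act_hom, Category.assoc, g.act_hom, comp_whiskerRight,
      Category.assoc]⟩

@[ext]
theorem hom_ext {M N : RightMod A} (f g : M ⟶ N) (h : f.hom = g.hom) : f = g := Hom.ext h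

@[simp]
theorem id_hom (M : RightMod A) : (𝟙 M : M ⟶ M).hom = 𝟙 M.X := rfl

@[simp]
theorem comp_hom {M N K : RightMod A} (f : M ⟶ N) (g : N ⟶ K) :
    (f ≫ g).hom = f.hom ≫ g.hom := rfl

/-- An isomorphism of right modules from an isomorphism in `C` that respects the actions. -/
@[simps]
def mkIso {M N : RightMod A} (e : M.X ≅ N.X) (h : M.act ≫ e.hom = e.hom ▷ A ≫ N.act) :
    M ≅ N where
  hom := ⟨e.hom, h⟩
  inv := ⟨e.inv, by
    rw [← cancel_mono e.hom, Category.assoc, Category.assoc, h, Iso.inv_hom_id, Category.comp_id,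
      ← Category.assoc, ← comp_whiskerRight, Iso.inv_hom_id, id_whiskerRight, Category.id_comp]⟩
  hom_inv_id := by ext; simp
  inv_hom_id := by ext; simp

variable (A) in
/-- The regular right module of `A`. -/
@[simps]
def regular : RightMod A where
  X := A
  act := MonObj.mul
  act_one := MonObj.mul_one A
  act_mul := by simp [MonObj.mul_assoc]

/-- The right module `X ⊗ M`. -/
@[simps]
def tensor (X : C) (M : RightMod A) : RightMod A where
  X := X ⊗ M.X
  act := (α_ X M.X A).hom ≫ X ◁ M.act
  act_one := by
    have h := congrArg (fun f => X ◁ f) M.act_one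
    simp only [MonoidalCategory.whiskerLeft_comp] at h
    simp [h]
  act_mul := by
    have h := congrArg (fun f => X ◁ f) M.act_mul
    simp only [MonoidalCategory.whiskerLeft_comp] at h
    simp [h]

theorem whiskerRight_act {X Y : C} (f : X ⟶ Y) (M : RightMod A) :
    ((α_ X M.X A).hom ≫ X ◁ M.act) ≫ f ▷ M.X
      = (f ▷ M.X) ▷ A ≫ (α_ Y M.X A).hom ≫ Y ◁ M.act := by
  simp [whisker_exchange]

theorem whiskerLeft_act (X : C) {M N : RightMod A} (f : M ⟶ N) :
    ((α_ X M.X A).hom ≫ X ◁ M.act) ≫ X ◁ f.hom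
      = (X ◁ f.hom) ▷ A ≫ (α_ X N.X A).hom ≫ X ◁ N.act := by
  have h := congrArg (fun f => X ◁ f) f.act_hom
  simp only [MonoidalCategory.whiskerLeft_comp] at h
  simp [h]

theorem associator_act (X Y : C) (M : RightMod A) :
    ((α_ (X ⊗ Y) M.X A).hom ≫ (X ⊗ Y) ◁ M.act) ≫ (α_ X Y M.X).hom
      = (α_ X Y M.X).hom ▷ A ≫ (α_ X (Y ⊗ M.X) A).hom ≫
        X ◁ ((α_ Y M.X A).hom ≫ Y ◁ M.act) := by
  simp

theorem leftUnitor_act (M : RightMod A) :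
    ((α_ (𝟙_ C) M.X A).hom ≫ 𝟙_ C ◁ M.act) ≫ (λ_ M.X).hom = (λ_ M.X).hom ▷ A ≫ M.act := by
  simp

/-- The left `C`-module category of right `A`-modules. -/
instance : MonoidalLeftAction C (RightMod A) where
  actionObj X M := tensor X M
  actionHomLeft f M := ⟨f ▷ M.X, whiskerRight_act f M⟩
  actionHomRight X _ _ f := ⟨X ◁ f.hom, whiskerLeft_act X f⟩
  actionHom f g := ⟨f ⊗ₘ g.hom, by
    rw [MonoidalCategory.tensorHom_def]
    exact (Hom.mk (M := tensor _ _) (N := tensor _ _) _ (whiskerRight_act f _) ≫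
      Hom.mk (M := tensor _ _) (N := tensor _ _) _ (whiskerLeft_act _ g) :
        tensor _ _ ⟶ tensor _ _).act_hom⟩
  actionAssocIso X Y M := mkIso (α_ X Y M.X) (associator_act X Y M)
  actionUnitIso M := mkIso (λ_ M.X) (leftUnitor_act M)
  actionHom_def f g := hom_ext _ _ (MonoidalCategory.tensorHom_def _ _)
  actionHomRight_id X M := hom_ext _ _ (MonoidalCategory.whiskerLeft_id _ _)
  id_actionHomLeft X M := hom_ext _ _ (MonoidalCategory.id_whiskerRight _ _)
  actionHom_comp f₁ f₂ g₁ g₂ := hom_ext _ _ (MonoidalCategory.tensorHom_comp_tensorHom _ _ _ _).symm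
  actionAssocIso_hom_naturality f g h := hom_ext _ _ (MonoidalCategory.associator_naturality _ _ _)
  actionUnitIso_hom_naturality f := hom_ext _ _ (MonoidalCategory.leftUnitor_naturality f.hom).symm
  whiskerLeft_actionHomLeft X _ _ f M := hom_ext _ _ (MonoidalCategory.whisker_assoc X f M.X)
  whiskerRight_actionHomLeft Y f M :=
    hom_ext _ _ (by
      change f ▷ Y ▷ M.X = (α_ _ _ _).hom ≫ f ▷ (Y ⊗ M.X) ≫ (α_ _ _ _).inv
      simp)
  associator_actionHom X Y Z M := hom_ext _ _ (MonoidalCategory.pentagon X Y Z M.X)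
  leftUnitor_actionHom X M := hom_ext _ _ (MonoidalCategory.leftUnitor_whiskerRight X M.X)
  rightUnitor_actionHom X M := hom_ext _ _ (MonoidalCategory.triangle X M.X).symm

end RightMod

end RightModules

section LeftModules

variable {C : Type u} [Category.{v} C] [MonoidalCategory C] {A : C} [MonObj A]

namespace LeftMod

/-- The action map of a left module. -/
abbrev act (M : Mod C A) : A ⊗ M.X ⟶ M.X := ModObj.smul (M := A) (X := M.X)

theorem hom_act {M N : Mod C A} (f : M ⟶ N) : act M ≫ f.hom = A ◁ f.hom ≫ act N :=
  IsModHom.smul_hom (A := A) (f := f.hom)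

/-- A morphism of left modules from a morphism in `C` that respects the actions. -/
def mkHom {M N : Mod C A} (f : M.X ⟶ N.X) (h : act M ≫ f = A ◁ f ≫ act N) : M ⟶ N :=
  Mod.Hom.mk' f h

@[simp]
theorem mkHom_hom {M N : Mod C A} (f : M.X ⟶ N.X) (h : act M ≫ f = A ◁ f ≫ act N) :
    (mkHom f h).hom = f := rfl

/-- An isomorphism of left modules from an isomorphism in `C` that respects the actions. -/
@[simps]
def mkIso {M N : Mod C A} (e : M.X ≅ N.X) (h : act M ≫ e.hom = A ◁ e.hom ≫ act N) : M ≅ N where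
  hom := mkHom e.hom h
  inv := mkHom e.inv (by
    rw [← cancel_mono e.hom, Category.assoc, Category.assoc, h, Iso.inv_hom_id, Category.comp_id,
      ← Category.assoc, ← MonoidalCategory.whiskerLeft_comp, Iso.inv_hom_id,
      MonoidalCategory.whiskerLeft_id, Category.id_comp])
  hom_inv_id := by ext; simp
  inv_hom_id := by ext; simp

theorem one_act (M : Mod C A) :
    (MonObj.one : 𝟙_ C ⟶ A) ▷ M.X ≫ act M = (λ_ M.X).hom := ModObj.one_smul_self A M.X

theorem mul_act (M : Mod C A) :
    (MonObj.mul : A ⊗ A ⟶ A) ▷ M.X ≫ act M = (α_ A A M.X).hom ≫ A ◁ act M ≫ act M :=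
  ModObj.mul_smul_self A M.X

theorem one_tensorAct (M : Mod C A) (X : C) :
    (MonObj.one : 𝟙_ C ⟶ A) ▷ (M.X ⊗ X) ≫ (α_ A M.X X).inv ≫ act M ▷ X
      = (λ_ (M.X ⊗ X)).hom := by
  have h := congrArg (fun f => f ▷ X) (one_act M)
  simp only [comp_whiskerRight] at h
  simp [h]

theorem mul_tensorAct (M : Mod C A) (X : C) :
    (MonObj.mul : A ⊗ A ⟶ A) ▷ (M.X ⊗ X) ≫ (α_ A M.X X).inv ≫ act M ▷ X
      = (α_ A A (M.X ⊗ X)).hom ≫ A ◁ ((α_ A M.X X).inv ≫ act M ▷ X) ≫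
        (α_ A M.X X).inv ≫ act M ▷ X := by
  have h := congrArg (fun f => f ▷ X) (mul_act M)
  simp only [comp_whiskerRight] at h
  simp [h]

/-- The left module `M ⊗ X`. -/
def tensor (M : Mod C A) (X : C) : Mod C A where
  X := M.X ⊗ X
  mod :=
    { smul := (α_ A M.X X).inv ≫ act M ▷ X
      one_smul := one_tensorAct M X
      mul_smul := mul_tensorAct M X }

theorem act_whiskerLeft (M : Mod C A) {X Y : C} (f : X ⟶ Y) :
    ((α_ A M.X X).inv ≫ act M ▷ X) ≫ M.X ◁ f
      = A ◁ (M.X ◁ f) ≫ (α_ A M.X Y).inv ≫ act M ▷ Y := by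
  simp [← whisker_exchange]

theorem act_whiskerRight {M N : Mod C A} (f : M ⟶ N) (X : C) :
    ((α_ A M.X X).inv ≫ act M ▷ X) ≫ f.hom ▷ X
      = A ◁ (f.hom ▷ X) ≫ (α_ A N.X X).inv ≫ act N ▷ X := by
  have h := congrArg (fun f => f ▷ X) (hom_act f)
  simp only [comp_whiskerRight] at h
  simp [h]

theorem act_associator (M : Mod C A) (X Y : C) :
    ((α_ A M.X (X ⊗ Y)).inv ≫ act M ▷ (X ⊗ Y)) ≫ (α_ M.X X Y).inv
      = A ◁ (α_ M.X X Y).inv ≫ (α_ A (M.X ⊗ X) Y).inv ≫ ((α_ A M.X X).inv ≫ act M ▷ X) ▷ Y := by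
  simp

theorem act_rightUnitor (M : Mod C A) :
    ((α_ A M.X (𝟙_ C)).inv ≫ act M ▷ 𝟙_ C) ≫ (ρ_ M.X).hom = A ◁ (ρ_ M.X).hom ≫ act M := by
  simp

/-- The right `C`-module category of left `A`-modules. -/
instance : MonoidalRightAction C (Mod C A) where
  actionObj M X := tensor M X
  actionHomRight M X Y f := mkHom (M := tensor M X) (N := tensor M Y) (M.X ◁ f)
    (act_whiskerLeft M f)
  actionHomLeft {M N} f X := mkHom (M := tensor M X) (N := tensor N X) (f.hom ▷ X)
    (act_whiskerRight f X)
  actionHom {X Y M N} f g := mkHom (M := tensor M X) (N := tensor N Y) (f.hom ⊗ₘ g) (by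
    rw [MonoidalCategory.tensorHom_def]
    exact hom_act (mkHom (M := tensor M X) (N := tensor N X) _ (act_whiskerRight f X) ≫
      mkHom (M := tensor N X) (N := tensor N Y) _ (act_whiskerLeft N g)))
  actionAssocIso M X Y := mkIso (M := tensor M (X ⊗ Y)) (N := tensor (tensor M X) Y)
    (α_ M.X X Y).symm (act_associator M X Y)
  actionUnitIso M := mkIso (M := tensor M (𝟙_ C)) (N := M) (ρ_ M.X) (act_rightUnitor M)
  actionHom_def f g := Mod.hom_ext _ _ (MonoidalCategory.tensorHom_def _ _)
  actionHomRight_id X M := Mod.hom_ext _ _ (MonoidalCategory.whiskerLeft_id _ _)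
  id_actionHomLeft X M := Mod.hom_ext _ _ (MonoidalCategory.id_whiskerRight _ _)
  actionHom_comp f₁ f₂ g₁ g₂ :=
    Mod.hom_ext _ _ (MonoidalCategory.tensorHom_comp_tensorHom _ _ _ _).symm
  actionAssocIso_hom_naturality f g h :=
    Mod.hom_ext _ _ (MonoidalCategory.associator_inv_naturality _ _ _)
  actionUnitIso_hom_naturality f :=
    Mod.hom_ext _ _ (MonoidalCategory.rightUnitor_naturality f.hom).symm
  actionHomRight_whiskerRight f X M :=
    Mod.hom_ext _ _ (by
      change M.X ◁ (f ▷ X) = (α_ _ _ _).inv ≫ (M.X ◁ f) ▷ X ≫ (α_ _ _ _).hom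
      simp)
  whiskerRight_actionHomLeft X _ _ f M :=
    Mod.hom_ext _ _ (by
      change M.X ◁ (X ◁ f) = (α_ _ _ _).inv ≫ (M.X ⊗ X) ◁ f ≫ (α_ _ _ _).hom
      simp)
  actionHom_associator X Y Z M :=
    Mod.hom_ext _ _ (by
      change M.X ◁ (α_ X Y Z).hom ≫ (α_ _ _ _).inv ≫ (α_ _ _ _).inv
        = (α_ _ _ _).inv ≫ (α_ _ _ _).inv ▷ Z
      simp)
  actionHom_leftUnitor X M :=
    Mod.hom_ext _ _ (by
      change M.X ◁ (λ_ X).hom = (α_ _ _ _).inv ≫ (ρ_ M.X).hom ▷ X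
      simp)
  actionHom_rightUnitor X M :=
    Mod.hom_ext _ _ (by
      change M.X ◁ (ρ_ X).hom = (α_ _ _ _).inv ≫ (ρ_ (M.X ⊗ X)).hom
      simp)

end LeftMod

end LeftModules

/-! ### The additive structure on categories of modules -/

section Preadditive

variable {C : Type u} [Category.{v} C] [Preadditive C] [MonoidalCategory C] [MonoidalPreadditive C]
  {A : C} [MonObj A]

instance (M N : RightMod A) : Add (M ⟶ N) where
  add f g := ⟨f.hom + g.hom, by simp [f.act_hom, g.act_hom, MonoidalPreadditive.add_whiskerRight]⟩

instance (M N : RightMod A) : Zero (M ⟶ N) where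
  zero := ⟨0, by simp⟩

instance (M N : RightMod A) : Neg (M ⟶ N) where
  neg f := ⟨-f.hom, by
    have h : (-f.hom) ▷ A = -(f.hom ▷ A) := ((tensoringRight C).obj A).map_neg
    rw [h]; simp [f.act_hom]⟩

instance (M N : RightMod A) : AddCommGroup (M ⟶ N) where
  nsmul := nsmulRec
  zsmul := zsmulRec
  add_assoc f g h := RightMod.hom_ext _ _ (add_assoc f.hom g.hom h.hom)
  zero_add f := RightMod.hom_ext _ _ (zero_add f.hom)
  add_zero f := RightMod.hom_ext _ _ (add_zero f.hom)
  neg_add_cancel f := RightMod.hom_ext _ _ (neg_add_cancel f.hom)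
  add_comm f g := RightMod.hom_ext _ _ (add_comm f.hom g.hom)

instance : Preadditive (RightMod A) where
  add_comp _ _ _ f g h := RightMod.hom_ext _ _ (Preadditive.add_comp _ _ _ f.hom g.hom h.hom)
  comp_add _ _ _ f g h := RightMod.hom_ext _ _ (Preadditive.comp_add _ _ _ f.hom g.hom h.hom)

instance (M N : Mod C A) : Add (M ⟶ N) where
  add f g := LeftMod.mkHom (f.hom + g.hom) (by
    rw [MonoidalPreadditive.whiskerLeft_add, Preadditive.comp_add, Preadditive.add_comp,
      LeftMod.hom_act, LeftMod.hom_act])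

instance (M N : Mod C A) : Zero (M ⟶ N) where
  zero := LeftMod.mkHom 0 (by rw [MonoidalPreadditive.whiskerLeft_zero, comp_zero, zero_comp])

instance (M N : Mod C A) : Neg (M ⟶ N) where
  neg f := LeftMod.mkHom (-f.hom) (by
    have h : A ◁ (-f.hom) = -(A ◁ f.hom) := ((tensoringLeft C).obj A).map_neg
    rw [h, Preadditive.comp_neg, Preadditive.neg_comp, LeftMod.hom_act])

instance (M N : Mod C A) : AddCommGroup (M ⟶ N) where
  nsmul := nsmulRec
  zsmul := zsmulRec
  add_assoc f g h := Mod.hom_ext _ _ (add_assoc f.hom g.hom h.hom)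
  zero_add f := Mod.hom_ext _ _ (zero_add f.hom)
  add_zero f := Mod.hom_ext _ _ (add_zero f.hom)
  neg_add_cancel f := Mod.hom_ext _ _ (neg_add_cancel f.hom)
  add_comm f g := Mod.hom_ext _ _ (add_comm f.hom g.hom)

theorem LeftMod.add_hom {M N : Mod C A} (f g : M ⟶ N) : (f + g).hom = f.hom + g.hom := rfl

instance : Preadditive (Mod C A) where
  add_comp _ _ _ f g h := Mod.hom_ext _ _ (by
    rw [Mod.comp_hom', LeftMod.add_hom, LeftMod.add_hom, Preadditive.add_comp,
      Mod.comp_hom', Mod.comp_hom'])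
  comp_add _ _ _ f g h := Mod.hom_ext _ _ (by
    rw [Mod.comp_hom', LeftMod.add_hom, LeftMod.add_hom, Preadditive.comp_add,
      Mod.comp_hom', Mod.comp_hom'])

end Preadditive

/-! ### Closed module categories, internal Homs and internal Ends -/

section ClosedLeft

variable (C : Type u) [Category.{v} C] [MonoidalCategory C]
  (D : Type u₂) [Category.{v₂} D] [MonoidalLeftAction C D]

/-- A left `C`-module category is closed if every functor `X ↦ X ▷ M` has a right adjoint. -/
class IsClosedLeft : Prop where
  isLeftAdjoint (M : D) : (MonoidalLeftAction.actionRight C M).IsLeftAdjoint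

attribute [instance] IsClosedLeft.isLeftAdjoint

variable {D} [IsClosedLeft C D]

open MonoidalLeftAction

/-- The internal Hom functor of an object of a closed left `C`-module category. -/
noncomputable def leftHom (M : D) : D ⥤ C := (actionRight C M).rightAdjoint

/-- The adjunction defining the internal Hom. -/
noncomputable def leftHomAdj (M : D) : actionRight C M ⊣ leftHom C M :=
  Adjunction.ofIsLeftAdjoint _

/-- The evaluation `Hom(M, N) ▷ M ⟶ N`. -/
noncomputable def leftEv (M N : D) : ((leftHom C M).obj N) ⊙ₗ M ⟶ N :=
  (leftHomAdj C M).counit.app N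

variable {C}

/-- The morphism `X ⟶ Hom(M, N)` corresponding to `X ▷ M ⟶ N`. -/
noncomputable def leftCurry {M N : D} {X : C} (f : X ⊙ₗ M ⟶ N) : X ⟶ (leftHom C M).obj N :=
  (leftHomAdj C M).homEquiv X N f

theorem leftCurry_ev {M N : D} {X : C} (f : X ⊙ₗ M ⟶ N) :
    leftCurry f ⊵ₗ M ≫ leftEv C M N = f := by
  have h := ((leftHomAdj C M).homEquiv X N).symm_apply_apply f
  rw [Adjunction.homEquiv_counit] at h
  exact h

theorem left_hom_ext {M N : D} {X : C} {f g : X ⟶ (leftHom C M).obj N}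
    (h : f ⊵ₗ M ≫ leftEv C M N = g ⊵ₗ M ≫ leftEv C M N) : f = g := by
  apply ((leftHomAdj C M).homEquiv X N).symm.injective
  rw [Adjunction.homEquiv_counit, Adjunction.homEquiv_counit]
  exact h

variable (C) in
/-- The internal End of an object of a closed left `C`-module category. -/
noncomputable def leftEnd (M : D) : C := (leftHom C M).obj M

variable (C) in
/-- The evaluation `End(M) ▷ M ⟶ M`. -/
noncomputable def leftEndEv (M : D) : leftEnd C M ⊙ₗ M ⟶ M := leftEv C M M

variable (C) in
/-- The unit of the internal End, corresponding to `1 ▷ M ≅ M`. -/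
noncomputable def leftEndOne (M : D) : 𝟙_ C ⟶ leftEnd C M := leftCurry (λₗ M).hom

variable (C) in
/-- The product of the internal End `E`, corresponding to
`(E ⊗ E) ▷ M ≅ E ▷ (E ▷ M) ⟶ E ▷ M ⟶ M`. -/
noncomputable def leftEndMul (M : D) : leftEnd C M ⊗ leftEnd C M ⟶ leftEnd C M :=
  leftCurry ((αₗ (leftEnd C M) (leftEnd C M) M).hom ≫
    leftEnd C M ⊴ₗ leftEndEv C M ≫ leftEndEv C M)

theorem leftEndOne_ev (M : D) : leftEndOne C M ⊵ₗ M ≫ leftEndEv C M = (λₗ M).hom :=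
  leftCurry_ev _

theorem leftEndMul_ev (M : D) : leftEndMul C M ⊵ₗ M ≫ leftEndEv C M =
    (αₗ (leftEnd C M) (leftEnd C M) M).hom ≫ leftEnd C M ⊴ₗ leftEndEv C M ≫ leftEndEv C M :=
  leftCurry_ev _

theorem leftEnd_ext {M : D} {X : C} {f g : X ⟶ leftEnd C M}
    (h : f ⊵ₗ M ≫ leftEndEv C M = g ⊵ₗ M ≫ leftEndEv C M) : f = g :=
  left_hom_ext h

/-- The algebra structure of the internal End. -/
noncomputable instance (M : D) : MonObj (leftEnd C M) where
  one := leftEndOne C M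
  mul := leftEndMul C M
  one_mul := by
    apply leftEnd_ext
    rw [comp_actionHomLeft, Category.assoc, leftEndMul_ev, whiskerRight_actionHomLeft,
      Category.assoc, Category.assoc, Iso.inv_hom_id_assoc, ← action_exchange_assoc,
      leftEndOne_ev, leftUnitor_actionHom, ← actionUnitIso_hom_naturality, Category.assoc]
  mul_one := by
    apply leftEnd_ext
    rw [comp_actionHomLeft, Category.assoc, leftEndMul_ev, whiskerLeft_actionHomLeft,
      Category.assoc, Category.assoc, Iso.inv_hom_id_assoc, ← actionHomRight_comp_assoc,
      leftEndOne_ev, rightUnitor_actionHom, Category.assoc]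
  mul_assoc := by
    have h := congrArg (fun f => leftEnd C M ⊴ₗ f) (leftEndMul_ev (C := C) M)
    simp only [actionHomRight_comp] at h
    apply leftEnd_ext
    rw [comp_actionHomLeft, comp_actionHomLeft, comp_actionHomLeft, Category.assoc,
      Category.assoc, Category.assoc, leftEndMul_ev, whiskerRight_actionHomLeft,
      Category.assoc, Category.assoc, Iso.inv_hom_id_assoc, ← action_exchange_assoc,
      leftEndMul_ev, tensor_actionHomRight, Category.assoc, Category.assoc,
      Iso.inv_hom_id_assoc, whiskerLeft_actionHomLeft, Category.assoc, Category.assoc,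
      Iso.inv_hom_id_assoc, reassoc_of% h, associator_actionHom_assoc]

end ClosedLeft

section ClosedRight

variable (C : Type u) [Category.{v} C] [MonoidalCategory C]
  (D : Type u₂) [Category.{v₂} D] [MonoidalRightAction C D]

/-- A right `C`-module category is closed if every functor `X ↦ N ◁ X` has a right adjoint. -/
class IsClosedRight : Prop where
  isLeftAdjoint (N : D) : (MonoidalRightAction.actionLeft C N).IsLeftAdjoint

attribute [instance] IsClosedRight.isLeftAdjoint

variable {D} [IsClosedRight C D]

open MonoidalRightAction

/-- The internal Hom functor of an object of a closed right `C`-module category. -/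
noncomputable def rightHom (N : D) : D ⥤ C := (actionLeft C N).rightAdjoint

/-- The adjunction defining the internal Hom. -/
noncomputable def rightHomAdj (N : D) : actionLeft C N ⊣ rightHom C N :=
  Adjunction.ofIsLeftAdjoint _

/-- The evaluation `N ◁ Hom(N, N') ⟶ N'`. -/
noncomputable def rightEv (N N' : D) : N ⊙ᵣ ((rightHom C N).obj N') ⟶ N' :=
  (rightHomAdj C N).counit.app N'

variable {C}

/-- The morphism `X ⟶ Hom(N, N')` corresponding to `N ◁ X ⟶ N'`. -/
noncomputable def rightCurry {N N' : D} {X : C} (f : N ⊙ᵣ X ⟶ N') : X ⟶ (rightHom C N).obj N' :=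
  (rightHomAdj C N).homEquiv X N' f

theorem rightCurry_ev {N N' : D} {X : C} (f : N ⊙ᵣ X ⟶ N') :
    N ⊴ᵣ rightCurry f ≫ rightEv C N N' = f := by
  have h := ((rightHomAdj C N).homEquiv X N').symm_apply_apply f
  rw [Adjunction.homEquiv_counit] at h
  exact h

theorem right_hom_ext {N N' : D} {X : C} {f g : X ⟶ (rightHom C N).obj N'}
    (h : N ⊴ᵣ f ≫ rightEv C N N' = N ⊴ᵣ g ≫ rightEv C N N') : f = g := by
  apply ((rightHomAdj C N).homEquiv X N').symm.injective
  rw [Adjunction.homEquiv_counit, Adjunction.homEquiv_counit]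
  exact h

variable (C) in
/-- The internal End of an object of a closed right `C`-module category. -/
noncomputable def rightEnd (N : D) : C := (rightHom C N).obj N

variable (C) in
/-- The evaluation `N ◁ End(N) ⟶ N`. -/
noncomputable def rightEndEv (N : D) : N ⊙ᵣ rightEnd C N ⟶ N := rightEv C N N

variable (C) in
/-- The unit of the internal End, corresponding to `N ◁ 1 ≅ N`. -/
noncomputable def rightEndOne (N : D) : 𝟙_ C ⟶ rightEnd C N := rightCurry (ρᵣ N).hom

variable (C) in
/-- The product of the internal End `E`, corresponding to
`N ◁ (E ⊗ E) ≅ (N ◁ E) ◁ E ⟶ N ◁ E ⟶ N`. -/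
noncomputable def rightEndMul (N : D) : rightEnd C N ⊗ rightEnd C N ⟶ rightEnd C N :=
  rightCurry ((αᵣ N (rightEnd C N) (rightEnd C N)).hom ≫
    rightEndEv C N ⊵ᵣ rightEnd C N ≫ rightEndEv C N)

theorem rightEndOne_ev (N : D) : N ⊴ᵣ rightEndOne C N ≫ rightEndEv C N = (ρᵣ N).hom :=
  rightCurry_ev _

theorem rightEndMul_ev (N : D) : N ⊴ᵣ rightEndMul C N ≫ rightEndEv C N =
    (αᵣ N (rightEnd C N) (rightEnd C N)).hom ≫
      rightEndEv C N ⊵ᵣ rightEnd C N ≫ rightEndEv C N :=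
  rightCurry_ev _

theorem rightEnd_ext {N : D} {X : C} {f g : X ⟶ rightEnd C N}
    (h : N ⊴ᵣ f ≫ rightEndEv C N = N ⊴ᵣ g ≫ rightEndEv C N) : f = g :=
  right_hom_ext h

/-- The algebra structure of the internal End. -/
noncomputable instance (N : D) : MonObj (rightEnd C N) where
  one := rightEndOne C N
  mul := rightEndMul C N
  one_mul := by
    apply rightEnd_ext
    rw [actionHomRight_comp, Category.assoc, rightEndMul_ev, actionHomRight_whiskerRight,
      Category.assoc, Category.assoc, Iso.inv_hom_id_assoc, ← comp_actionHomLeft_assoc,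
      rightEndOne_ev, actionHom_leftUnitor, Category.assoc]
  mul_one := by
    apply rightEnd_ext
    rw [actionHomRight_comp, Category.assoc, rightEndMul_ev, whiskerRight_actionHomLeft,
      Category.assoc, Category.assoc, Iso.inv_hom_id_assoc, action_exchange_assoc,
      rightEndOne_ev, actionHom_rightUnitor, ← actionUnitIso_hom_naturality, Category.assoc]
  mul_assoc := by
    have h := congrArg (fun f => f ⊵ᵣ rightEnd C N) (rightEndMul_ev (C := C) N)
    simp only [comp_actionHomLeft] at h
    apply rightEnd_ext
    rw [actionHomRight_comp, actionHomRight_comp, actionHomRight_comp, Category.assoc,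
      Category.assoc, Category.assoc, rightEndMul_ev, actionHomRight_whiskerRight,
      Category.assoc, Category.assoc, Iso.inv_hom_id_assoc, reassoc_of% h,
      whiskerRight_actionHomLeft, Category.assoc, Category.assoc, Iso.inv_hom_id_assoc,
      action_exchange_assoc, rightEndMul_ev, actionHomLeft_tensor, Category.assoc, Category.assoc,
      Iso.inv_hom_id_assoc, actionHom_associator_assoc]

end ClosedRight

/-! ### Modules over an algebra in a rigid category form closed module categories -/

section Universal

variable {C : Type u} [Category.{v} C]

theorem isLeftAdjoint_of_universal {D : Type u₂} [Category.{v₂} D] (F : C ⥤ D)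
    (h : ∀ N : D, ∃ (H : C) (ev : F.obj H ⟶ N), ∀ (X : C) (f : F.obj X ⟶ N),
      ∃! g : X ⟶ H, F.map g ≫ ev = f) : F.IsLeftAdjoint := by
  choose H ev u using h
  choose g hg hu using u
  exact (Adjunction.adjunctionOfEquivRight (F := F) (G_obj := H)
    (fun X N => (⟨fun f => g N X f, fun k => F.map k ≫ ev N, fun f => hg N X f,
      fun k => (hu N X _ k rfl).symm⟩ : (F.obj X ⟶ N) ≃ (X ⟶ H N)))
    (fun X' X N k f => (hu N X' _ _ (by
      simp only [Functor.map_comp, Category.assoc]; erw [hg N X f])).symm)).isLeftAdjoint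

theorem exists_universal [HasEqualizers C] (T T' : C ⥤ C) [T.IsLeftAdjoint] [T'.IsLeftAdjoint]
    (N : C) (Φ Ψ : ∀ X, (T.obj X ⟶ N) → (T'.obj X ⟶ N))
    (hΦ : ∀ {X Y : C} (g : X ⟶ Y) (f : T.obj Y ⟶ N), Φ X (T.map g ≫ f) = T'.map g ≫ Φ Y f)
    (hΨ : ∀ {X Y : C} (g : X ⟶ Y) (f : T.obj Y ⟶ N), Ψ X (T.map g ≫ f) = T'.map g ≫ Ψ Y f) :
    ∃ (H : C) (ev : T.obj H ⟶ N), Φ H ev = Ψ H ev ∧ ∀ (X : C) (f : T.obj X ⟶ N),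
      Φ X f = Ψ X f → ∃! g : X ⟶ H, T.map g ≫ ev = f := by
  let adj := Adjunction.ofIsLeftAdjoint T
  let adj' := Adjunction.ofIsLeftAdjoint T'
  let ε := adj.counit.app N
  let a := adj'.homEquiv _ _ (Φ _ ε)
  let b := adj'.homEquiv _ _ (Ψ _ ε)
  have key {X : C} (g : X ⟶ T.rightAdjoint.obj N) :
      g ≫ a = g ≫ b ↔ Φ X (T.map g ≫ ε) = Ψ X (T.map g ≫ ε) := by
    rw [hΦ, hΨ, ← (adj'.homEquiv _ _).apply_eq_iff_eq, adj'.homEquiv_naturality_left,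
      adj'.homEquiv_naturality_left]
  have surj {X : C} (f : T.obj X ⟶ N) : T.map (adj.homEquiv _ _ f) ≫ ε = f := by
    have h := (adj.homEquiv X N).symm_apply_apply f
    rwa [adj.homEquiv_counit] at h
  refine ⟨equalizer a b, T.map (equalizer.ι a b) ≫ ε, (key _).1 (equalizer.condition a b), ?_⟩
  intro X f hf
  refine ⟨equalizer.lift (adj.homEquiv _ _ f) ((key _).2 (by rw [surj]; exact hf)), ?_, ?_⟩
  · change T.map _ ≫ T.map _ ≫ ε = f
    rw [← T.map_comp_assoc, equalizer.lift_ι, surj]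
  · intro g hg
    apply equalizer.hom_ext
    rw [equalizer.lift_ι, ← (adj.homEquiv _ _).symm.apply_eq_iff_eq, Equiv.symm_apply_apply,
      adj.homEquiv_counit, T.map_comp, Category.assoc]
    exact hg

end Universal

section ModulesClosed

variable {C : Type u} [Category.{v} C] [MonoidalCategory C] {A : C} [MonObj A]

instance [HasEqualizers C] [RightRigidCategory C] : IsClosedLeft C (RightMod A) where
  isLeftAdjoint M := isLeftAdjoint_of_universal _ (fun N => by
    have h (X : C) : (tensorRight X).IsLeftAdjoint := (tensorRightAdjunction X (Xᘁ)).isLeftAdjoint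
    obtain ⟨H, ev, hev, hu⟩ := exists_universal (tensorRight M.X) (tensorRight (M.X ⊗ A)) N.X
      (fun X f => (α_ X M.X A).inv ≫ f ▷ A ≫ N.act) (fun X f => X ◁ M.act ≫ f)
      (fun g f => by simp) (fun g f => by
        change _ ◁ M.act ≫ g ▷ M.X ≫ f = g ▷ (M.X ⊗ A) ≫ _ ◁ M.act ≫ f
        rw [whisker_exchange_assoc])
    have key {X : C} (f : X ⊗ M.X ⟶ N.X) :
        (α_ X M.X A).inv ≫ f ▷ A ≫ N.act = X ◁ M.act ≫ f ↔
          ((α_ X M.X A).hom ≫ X ◁ M.act) ≫ f = f ▷ A ≫ N.act := by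
      rw [Iso.inv_comp_eq, Category.assoc, eq_comm]
    refine ⟨H, RightMod.Hom.mk ev ((key ev).1 hev), fun X f => ?_⟩
    obtain ⟨g, hg, hg'⟩ := hu X f.hom ((key _).2 f.act_hom)
    exact ⟨g, RightMod.hom_ext _ _ hg, fun k hk => hg' k (congrArg RightMod.Hom.hom hk)⟩)

instance [HasEqualizers C] [LeftRigidCategory C] : IsClosedRight C (Mod C A) where
  isLeftAdjoint M := isLeftAdjoint_of_universal _ (fun N => by
    have h (X : C) : (tensorLeft X).IsLeftAdjoint := (tensorLeftAdjunction (ᘁX) X).isLeftAdjoint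
    obtain ⟨H, ev, hev, hu⟩ := exists_universal (tensorLeft M.X) (tensorLeft (A ⊗ M.X)) N.X
      (fun X f => (α_ A M.X X).hom ≫ A ◁ f ≫ LeftMod.act N) (fun X f => LeftMod.act M ▷ X ≫ f)
      (fun g f => by simp) (fun g f => by
        change LeftMod.act M ▷ _ ≫ M.X ◁ g ≫ f = (A ⊗ M.X) ◁ g ≫ LeftMod.act M ▷ _ ≫ f
        rw [whisker_exchange_assoc])
    have key {X : C} (f : M.X ⊗ X ⟶ N.X) :
        (α_ A M.X X).hom ≫ A ◁ f ≫ LeftMod.act N = LeftMod.act M ▷ X ≫ f ↔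
          ((α_ A M.X X).inv ≫ LeftMod.act M ▷ X) ≫ f = A ◁ f ≫ LeftMod.act N := by
      rw [Category.assoc, Iso.inv_comp_eq, eq_comm]
    refine ⟨H, LeftMod.mkHom (M := LeftMod.tensor M H) ev ((key ev).1 hev), fun X f => ?_⟩
    obtain ⟨g, hg, hg'⟩ := hu X f.hom ((key _).2 (LeftMod.hom_act f))
    exact ⟨g, Mod.hom_ext _ _ hg, fun k hk => hg' k (congrArg Mod.Hom.hom hk)⟩)

end ModulesClosed

/-! ### Simplistic division algebras -/

section Simplistic

variable {C : Type u} [Category.{v} C] [Preadditive C] [MonoidalCategory C] [MonoidalPreadditive C]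

/-- A nonzero algebra whose regular right module is simple. -/
def IsRightSimplistic (B : C) [MonObj B] : Prop :=
  ¬ IsZero B ∧ Simple (RightMod.regular B)

/-- A nonzero algebra whose regular left module is simple. -/
def IsLeftSimplistic (B : C) [MonObj B] : Prop :=
  ¬ IsZero B ∧ Simple (Mod.regular B)

end Simplistic

/-! ### Semisimple, multifusion, and indecomposable module categories -/

/-- Every object is a finite direct sum of simple objects. -/
def IsSemisimpleCat (D : Type u) [Category.{v} D] [HasZeroMorphisms D] : Prop :=
  ∀ X : D, ∃ (n : ℕ) (S : Fin n → D) (b : Bicone S),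
    (∀ i, Simple (S i)) ∧ Nonempty b.IsBilimit ∧ Nonempty (b.pt ≅ X)

/-- Multifusion categories over `k`: the abelian, `k`-linear monoidal and rigid structures are
the instance arguments; the fields say that the underlying category is finite and semisimple. -/
class IsMultifusion (k : Type w) [Field k] (C : Type u) [Category.{v} C] [Abelian C] [Linear k C]
    [MonoidalCategory C] [MonoidalPreadditive C] [MonoidalLinear k C] [RigidCategory C] :
    Prop where
  finite_hom (X Y : C) : Module.Finite k (X ⟶ Y)
  /-- Every object has finite length, i.e. is both Noetherian and Artinian. -/
  noetherian (X : C) : IsNoetherianObject X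
  artinian (X : C) : IsArtinianObject X
  enoughProjectives : EnoughProjectives C
  finite_simples : ∃ (n : ℕ) (S : Fin n → C), ∀ X : C, Simple X → ∃ i, Nonempty (X ≅ S i)
  semisimple : IsSemisimpleCat C

/-- The category `D` is the direct sum of its full subcategories `P` and `Q`: there are no
nonzero morphisms between them, and every object is a direct sum of an object of `P` and an
object of `Q`. -/
structure IsDirectSum {D : Type u} [Category.{v} D] [HasZeroMorphisms D]
    (P Q : ObjectProperty D) : Prop where
  isoClosed_left : P.IsClosedUnderIsomorphisms
  isoClosed_right : Q.IsClosedUnderIsomorphisms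
  hom_eq_zero {X Y : D} (hX : P X) (hY : Q Y) (f : X ⟶ Y) : f = 0
  hom_eq_zero' {X Y : D} (hX : P X) (hY : Q Y) (f : Y ⟶ X) : f = 0
  exists_sum (Z : D) : ∃ (X Y : D) (b : BinaryBicone X Y),
    P X ∧ Q Y ∧ Nonempty b.IsBilimit ∧ Nonempty (b.pt ≅ Z)

/-- A left `C`-module category is indecomposable if it is not the direct sum of two nonzero
module subcategories. -/
def IsIndecomposableLeft (C : Type u) [Category.{v} C] [MonoidalCategory C]
    (D : Type u₂) [Category.{v₂} D] [HasZeroMorphisms D] [MonoidalLeftAction C D] : Prop :=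
  ∀ P Q : ObjectProperty D, IsDirectSum P Q →
    (∀ (c : C) (X : D), P X → P (MonoidalLeftAction.actionObj c X)) →
    (∀ (c : C) (X : D), Q X → Q (MonoidalLeftAction.actionObj c X)) →
    (∀ X, P X → IsZero X) ∨ (∀ X, Q X → IsZero X)

/-- A right `C`-module category is indecomposable if it is not the direct sum of two nonzero
module subcategories. -/
def IsIndecomposableRight (C : Type u) [Category.{v} C] [MonoidalCategory C]
    (D : Type u₂) [Category.{v₂} D] [HasZeroMorphisms D] [MonoidalRightAction C D] : Prop :=
  ∀ P Q : ObjectProperty D, IsDirectSum P Q →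
    (∀ (X : D) (c : C), P X → P (MonoidalRightAction.actionObj X c)) →
    (∀ (X : D) (c : C), Q X → Q (MonoidalRightAction.actionObj X c)) →
    (∀ X, P X → IsZero X) ∨ (∀ X, Q X → IsZero X)

/-- The hypotheses on a left module category: semisimple, nonzero, indecomposable. -/
structure OstrikLeft (C : Type u) [Category.{v} C] [MonoidalCategory C]
    (D : Type u₂) [Category.{v₂} D] [HasZeroMorphisms D] [MonoidalLeftAction C D] : Prop where
  semisimple : IsSemisimpleCat D
  nonzero : ∃ X : D, ¬ IsZero X
  indecomposable : IsIndecomposableLeft C D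

/-- The hypotheses on a right module category: semisimple, nonzero, indecomposable. -/
structure OstrikRight (C : Type u) [Category.{v} C] [MonoidalCategory C]
    (D : Type u₂) [Category.{v₂} D] [HasZeroMorphisms D] [MonoidalRightAction C D] : Prop where
  semisimple : IsSemisimpleCat D
  nonzero : ∃ X : D, ¬ IsZero X
  indecomposable : IsIndecomposableRight C D

end DivAlg

/-! Put `E = End(M)`. Two facts about `E` carry both directions.

If `E` is simple over itself, then `M` is simple: postcomposition embeds the monoid of endomorphisms
of `M` into the endomorphisms of the regular right `E`-module (`leftEndPostcomp_injective`). By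
Schur's lemma an idempotent of `M` becomes zero or invertible there, so it is `0` or `1`; a nonzero
object of a semisimple category with only these idempotents is simple.

If `M` is simple, let `I` be a nonzero right ideal of `E`. The map `I ▷ M ⟶ E ▷ M ⟶ M` corresponds
to the inclusion of `I` under the internal Hom adjunction, so it is nonzero, and semisimplicity with
Schur's lemma gives it a section `s`. Rigidity turns `s` into an element of `I` that equals the unit
of `E` (`exists_unit_of_section_left`), and an ideal that contains the unit is everything
(`RightMod.isIso_of_unit`).

Statement (ii) is the mirror image, with left ideals and left duals. -/

namespace DivAlg

/-! ### Idempotents and splittings in semisimple categories -/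

section Semisimple

variable {D : Type u} [Category.{v} D] [Preadditive D]

/-- In a semisimple category that satisfies Schur's lemma, every nonzero morphism to a simple
object is a split epimorphism. -/
theorem IsSemisimpleCat.exists_section (hD : IsSemisimpleCat D)
    (schur : ∀ {S T : D} (f : S ⟶ T), Simple S → Simple T → f ≠ 0 → IsIso f)
    {X M : D} (hM : Simple M) {p : X ⟶ M} (hp : p ≠ 0) : ∃ s : M ⟶ X, s ≫ p = 𝟙 M := by
  obtain ⟨n, S, b, hS, ⟨hb⟩, ⟨e⟩⟩ := hD X
  -- The summand inclusions are jointly epic, so `p` is nonzero on some simple summand; by Schur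
  -- that summand maps isomorphically to `M`, and the inverse gives the section.
  obtain ⟨i, hi⟩ : ∃ i, b.ι i ≫ e.hom ≫ p ≠ 0 := by
    by_contra! h
    apply hp
    rw [← cancel_epi e.hom, comp_zero]
    exact hb.isColimit.hom_ext (fun ⟨j⟩ => by simpa using h j)
  have := schur _ (hS i) hM hi
  exact ⟨inv (b.ι i ≫ e.hom ≫ p) ≫ b.ι i ≫ e.hom, by simp⟩

/-- In a semisimple category, a nonzero object without nontrivial idempotents is simple. -/
theorem IsSemisimpleCat.simple_of_idempotents (hD : IsSemisimpleCat D) {M : D}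
    (h1 : 𝟙 M ≠ 0) (h : ∀ e : M ⟶ M, e ≫ e = e → e = 0 ∨ e = 𝟙 M) : Simple M := by
  obtain ⟨n, S, b, hS, ⟨hb⟩, ⟨e⟩⟩ := hD M
  -- The projection of `M` onto each simple summand is an idempotent. If one is the identity, `M` is
  -- that summand; if all vanish, so does `𝟙 M`.
  have hi (i : Fin n) : (e.inv ≫ b.π i) ≫ b.ι i ≫ e.hom = 0 ∨
      (e.inv ≫ b.π i) ≫ b.ι i ≫ e.hom = 𝟙 M := h _ (by simp)
  by_cases hz : ∃ i, (e.inv ≫ b.π i) ≫ b.ι i ≫ e.hom = 𝟙 M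
  · obtain ⟨i, hi⟩ := hz
    have := hS i
    exact Simple.of_iso (Y := S i) ⟨e.inv ≫ b.π i, b.ι i ≫ e.hom, hi, by simp⟩
  · exfalso
    apply h1
    rw [← cancel_epi e.hom, comp_zero]
    refine hb.isColimit.hom_ext (fun ⟨j⟩ => ?_)
    have hj := (hi j).resolve_right (fun h' => hz ⟨j, h'⟩)
    simpa using congrArg (fun f => b.ι j ≫ e.hom ≫ f) hj

end Semisimple

/-! ### Schur's lemma for modules -/

section Schur

variable {C : Type u} [Category.{v} C] [MonoidalCategory C] {A : C} [MonObj A]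

theorem RightMod.mono_of_mono_hom {M N : RightMod A} (f : M ⟶ N) [Mono f.hom] : Mono f where
  right_cancellation g h w := by
    ext
    rw [← cancel_mono f.hom]
    exact congrArg RightMod.Hom.hom w

theorem LeftMod.mono_of_mono_hom {M N : Mod C A} (f : M ⟶ N) [Mono f.hom] : Mono f where
  right_cancellation g h w := by
    ext
    rw [← cancel_mono f.hom]
    exact congrArg Mod.Hom.hom w

variable [Preadditive C] [MonoidalPreadditive C] [HasKernels C]

/-- The kernel of a morphism of right modules. -/
noncomputable def RightMod.ker {M N : RightMod A} (f : M ⟶ N) : RightMod A where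
  X := kernel f.hom
  act := kernel.lift f.hom (kernel.ι f.hom ▷ A ≫ M.act) (by
    rw [Category.assoc, f.act_hom, ← comp_whiskerRight_assoc, kernel.condition,
      MonoidalPreadditive.zero_whiskerRight, zero_comp])
  act_one := by
    rw [← cancel_mono (kernel.ι f.hom), Category.assoc, kernel.lift_ι, whisker_exchange_assoc,
      M.act_one, rightUnitor_naturality]
  act_mul := by
    rw [← cancel_mono (kernel.ι f.hom)]
    simp only [Category.assoc, kernel.lift_ι]
    rw [whisker_exchange_assoc, M.act_mul, ← comp_whiskerRight_assoc, kernel.lift_ι]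
    simp

/-- The inclusion of the kernel of a morphism of right modules. -/
noncomputable def RightMod.kerι {M N : RightMod A} (f : M ⟶ N) : RightMod.ker f ⟶ M where
  hom := kernel.ι f.hom
  act_hom := kernel.lift_ι _ _ _

instance {M N : RightMod A} (f : M ⟶ N) : Mono (RightMod.kerι f) :=
  have : Mono (RightMod.kerι f).hom := inferInstanceAs (Mono (kernel.ι f.hom))
  RightMod.mono_of_mono_hom _

/-- Schur's lemma from kernels alone: simplicity of `M` makes the kernel inclusion zero, so `f` is
monic, and simplicity of `N` makes a nonzero monomorphism invertible. -/
theorem RightMod.isIso_of_simple {M N : RightMod A} (f : M ⟶ N) (hM : Simple M) (hN : Simple N)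
    (hf : f ≠ 0) : IsIso f := by
  have h0 : RightMod.kerι f = 0 := by
    by_contra h
    have := isIso_of_mono_of_nonzero h
    apply hf
    rw [← cancel_epi (RightMod.kerι f), comp_zero]
    exact RightMod.hom_ext _ _ (kernel.condition f.hom)
  -- The map underlying `kerι f` is the kernel inclusion in `C`, so its vanishing makes `f` monic
  -- already in `C`.
  have : Mono f.hom := Preadditive.mono_of_kernel_zero (congrArg RightMod.Hom.hom h0)
  have := RightMod.mono_of_mono_hom f
  exact isIso_of_mono_of_nonzero hf

/-- The action on the kernel of a morphism of left modules. -/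
noncomputable def LeftMod.kerAct {M N : Mod C A} (f : M ⟶ N) :
    A ⊗ kernel f.hom ⟶ kernel f.hom :=
  kernel.lift f.hom (A ◁ kernel.ι f.hom ≫ act M) (by
    rw [Category.assoc, hom_act, ← MonoidalCategory.whiskerLeft_comp_assoc, kernel.condition,
      MonoidalPreadditive.whiskerLeft_zero, zero_comp])

theorem LeftMod.kerAct_ι {M N : Mod C A} (f : M ⟶ N) :
    kerAct f ≫ kernel.ι f.hom = A ◁ kernel.ι f.hom ≫ act M :=
  kernel.lift_ι _ _ _

theorem LeftMod.one_kerAct {M N : Mod C A} (f : M ⟶ N) :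
    (MonObj.one : 𝟙_ C ⟶ A) ▷ kernel f.hom ≫ kerAct f = (λ_ (kernel f.hom)).hom := by
  rw [← cancel_mono (kernel.ι f.hom), Category.assoc, kerAct_ι, ← whisker_exchange_assoc,
    one_act, leftUnitor_naturality]

theorem LeftMod.mul_kerAct {M N : Mod C A} (f : M ⟶ N) :
    (MonObj.mul : A ⊗ A ⟶ A) ▷ kernel f.hom ≫ kerAct f
      = (α_ A A (kernel f.hom)).hom ≫ A ◁ kerAct f ≫ kerAct f := by
  rw [← cancel_mono (kernel.ι f.hom)]
  simp only [Category.assoc, kerAct_ι]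
  rw [← whisker_exchange_assoc, mul_act, ← MonoidalCategory.whiskerLeft_comp_assoc, kerAct_ι]
  simp

/-- The kernel of a morphism of left modules. -/
noncomputable def LeftMod.ker {M N : Mod C A} (f : M ⟶ N) : Mod C A where
  X := kernel f.hom
  mod :=
    { smul := kerAct f
      one_smul := one_kerAct f
      mul_smul := mul_kerAct f }

/-- The inclusion of the kernel of a morphism of left modules. -/
noncomputable def LeftMod.kerι {M N : Mod C A} (f : M ⟶ N) : LeftMod.ker f ⟶ M :=
  mkHom (M := LeftMod.ker f) (kernel.ι f.hom) (kerAct_ι f)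

instance {M N : Mod C A} (f : M ⟶ N) : Mono (LeftMod.kerι f) :=
  have : Mono (LeftMod.kerι f).hom := inferInstanceAs (Mono (kernel.ι f.hom))
  LeftMod.mono_of_mono_hom _

theorem LeftMod.isIso_of_simple {M N : Mod C A} (f : M ⟶ N) (hM : Simple M) (hN : Simple N)
    (hf : f ≠ 0) : IsIso f := by
  have h0 : LeftMod.kerι f = 0 := by
    by_contra h
    have := isIso_of_mono_of_nonzero h
    apply hf
    rw [← cancel_epi (LeftMod.kerι f), comp_zero]
    exact Mod.hom_ext _ _ (kernel.condition f.hom)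
  have : Mono f.hom := Preadditive.mono_of_kernel_zero (congrArg Mod.Hom.hom h0)
  have := LeftMod.mono_of_mono_hom f
  exact isIso_of_mono_of_nonzero hf

end Schur

/-! ### Submodules of the regular module that contain the unit -/

section Unit

variable {C : Type u} [Category.{v} C] [MonoidalCategory C] {B : C} [MonObj B]

theorem RightMod.mul_ofElement (I : RightMod B) (u : 𝟙_ C ⟶ I.X) :
    (MonObj.mul : B ⊗ B ⟶ B) ≫ (λ_ B).inv ≫ u ▷ B ≫ I.act
      = ((λ_ B).inv ≫ u ▷ B ≫ I.act) ▷ B ≫ I.act := by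
  rw [leftUnitor_inv_naturality_assoc, whisker_exchange_assoc, I.act_mul]
  simp

/-- The morphism of right modules `B ⟶ I` that sends the unit to a given element. -/
def RightMod.ofElement (I : RightMod B) (u : 𝟙_ C ⟶ I.X) : RightMod.regular B ⟶ I where
  hom := (λ_ B).inv ≫ u ▷ B ≫ I.act
  act_hom := I.mul_ofElement u

/-- In elements: `j(u · b) = j(u) · b = 1 · b = b`. -/
theorem RightMod.ofElement_comp {I : RightMod B} {u : 𝟙_ C ⟶ I.X} {j : I.X ⟶ B}
    (hj : I.act ≫ j = j ▷ B ≫ MonObj.mul) (hu : u ≫ j = MonObj.one) :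
    ((λ_ B).inv ≫ u ▷ B ≫ I.act) ≫ j = 𝟙 B := by
  rw [Category.assoc, Category.assoc, hj, ← comp_whiskerRight_assoc, hu, MonObj.one_mul,
    Iso.inv_hom_id]

/-- The map `b ↦ u · b` is a section of `i`, and a split epimorphism that is monic is invertible. -/
theorem RightMod.isIso_of_unit {I : RightMod B} (i : I ⟶ RightMod.regular B) [Mono i]
    (u : 𝟙_ C ⟶ I.X) (hu : u ≫ i.hom = (MonObj.one : 𝟙_ C ⟶ B)) : IsIso i := by
  have : IsSplitEpi i := ⟨⟨⟨I.ofElement u, hom_ext _ _ (ofElement_comp (B := B) i.act_hom hu)⟩⟩⟩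
  exact isIso_of_mono_of_isSplitEpi i

theorem LeftMod.mul_ofElement (I : Mod C B) (u : 𝟙_ C ⟶ I.X) :
    (MonObj.mul : B ⊗ B ⟶ B) ≫ (ρ_ B).inv ≫ B ◁ u ≫ act I
      = B ◁ ((ρ_ B).inv ≫ B ◁ u ≫ act I) ≫ act I := by
  rw [rightUnitor_inv_naturality_assoc, ← whisker_exchange_assoc, mul_act]
  simp

/-- The morphism of left modules `B ⟶ I` that sends the unit to a given element. -/
def LeftMod.ofElement (I : Mod C B) (u : 𝟙_ C ⟶ I.X) : Mod.regular B ⟶ I :=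
  mkHom (M := Mod.regular B) ((ρ_ B).inv ≫ B ◁ u ≫ act I) (mul_ofElement I u)

theorem LeftMod.ofElement_comp {I : Mod C B} {u : 𝟙_ C ⟶ I.X} {j : I.X ⟶ B}
    (hj : act I ≫ j = B ◁ j ≫ MonObj.mul) (hu : u ≫ j = MonObj.one) :
    ((ρ_ B).inv ≫ B ◁ u ≫ act I) ≫ j = 𝟙 B := by
  rw [Category.assoc, Category.assoc, hj, ← MonoidalCategory.whiskerLeft_comp_assoc, hu,
    MonObj.mul_one, Iso.inv_hom_id]

theorem LeftMod.isIso_of_unit {I : Mod C B} (i : I ⟶ Mod.regular B) [Mono i]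
    (u : 𝟙_ C ⟶ I.X) (hu : u ≫ i.hom = (MonObj.one : 𝟙_ C ⟶ B)) : IsIso i := by
  have : IsSplitEpi i :=
    ⟨⟨⟨ofElement I u, Mod.hom_ext _ _ (ofElement_comp (B := B) (hom_act i) hu)⟩⟩⟩
  exact isIso_of_mono_of_isSplitEpi i

end Unit

/-! ### Duality in module categories -/

section ZigzagLeft

open MonoidalLeftAction

variable {C : Type u} [Category.{v} C] [MonoidalCategory C]
  {D : Type u₂} [Category.{v₂} D] [MonoidalLeftAction C D]

/-- The zigzag identity for `X`, acted on `M`. The pentagon of the action (`hα`) moves the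
associators into the position in which they occur when coevaluation acts on `X ▷ M`. -/
theorem coevaluation_evaluation_action (X Y : C) [ExactPairing X Y] (M : D) :
    η_ X Y ⊵ₗ (X ⊙ₗ M) ≫ (αₗ X Y (X ⊙ₗ M)).hom ≫ X ⊴ₗ (αₗ Y X M).inv ≫ X ⊴ₗ ε_ X Y ⊵ₗ M ≫
      X ⊴ₗ (λₗ M).hom = (λₗ (X ⊙ₗ M)).hom := by
  have h : η_ X Y ▷ X ≫ (α_ X Y X).hom ≫ X ◁ ε_ X Y ≫ (ρ_ X).hom = (λ_ X).hom := by simp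
  have h' := congrArg (fun f => f ⊵ₗ M) h
  simp only [comp_actionHomLeft, leftUnitor_actionHom, rightUnitor_actionHom,
    whiskerLeft_actionHomLeft, whiskerRight_actionHomLeft, Category.assoc,
    Iso.inv_hom_id_assoc, cancel_epi] at h'
  have hα : (αₗ X Y (X ⊙ₗ M)).hom ≫ X ⊴ₗ (αₗ Y X M).inv =
      (αₗ (X ⊗ Y) X M).inv ≫ (α_ X Y X).hom ⊵ₗ M ≫ (αₗ X (Y ⊗ X) M).hom := by
    rw [Iso.eq_inv_comp, ← cancel_mono (X ⊴ₗ (αₗ Y X M).hom)]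
    simp only [Category.assoc, actionHomRight_inv_hom, Category.comp_id, associator_actionHom]
  rw [← h', reassoc_of% hα]

end ZigzagLeft

section ZigzagRight

open MonoidalRightAction

variable {C : Type u} [Category.{v} C] [MonoidalCategory C]
  {D : Type u₂} [Category.{v₂} D] [MonoidalRightAction C D]

/-- The other zigzag identity, the one for `Y`, acted on by `N`. -/
theorem action_coevaluation_evaluation (X Y : C) [ExactPairing X Y] (N : D) :
    (N ⊙ᵣ Y) ⊴ᵣ η_ X Y ≫ (αᵣ (N ⊙ᵣ Y) X Y).hom ≫ (αᵣ N Y X).inv ⊵ᵣ Y ≫ (N ⊴ᵣ ε_ X Y) ⊵ᵣ Y ≫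
      (ρᵣ N).hom ⊵ᵣ Y = (ρᵣ (N ⊙ᵣ Y)).hom := by
  have h : Y ◁ η_ X Y ≫ (α_ Y X Y).inv ≫ ε_ X Y ▷ Y ≫ (λ_ Y).hom = (ρ_ Y).hom := by simp
  have h' := congrArg (fun f => N ⊴ᵣ f) h
  simp only [actionHomRight_comp, actionHom_leftUnitor, actionHom_rightUnitor,
    whiskerRight_actionHomLeft, actionHomRight_whiskerRight, Category.assoc,
    Iso.inv_hom_id_assoc, cancel_epi] at h'
  have hα : (αᵣ (N ⊙ᵣ Y) X Y).hom ≫ (αᵣ N Y X).inv ⊵ᵣ Y =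
      (αᵣ N Y (X ⊗ Y)).inv ≫ N ⊴ᵣ (α_ Y X Y).inv ≫ (αᵣ N (Y ⊗ X) Y).hom := by
    rw [Iso.eq_inv_comp, ← cancel_epi (N ⊴ᵣ (α_ Y X Y).hom), actionHom_associator_assoc,
      hom_inv_actionHomLeft, Category.comp_id, actionHomRight_hom_inv_assoc]
  rw [← h', reassoc_of% hα]

end ZigzagRight

/-! ### Ideals of internal Ends -/

section InternalEndLeft

open MonoidalLeftAction

variable {C : Type u} [Category.{v} C] [MonoidalCategory C]
  {D : Type u₂} [Category.{v₂} D] [MonoidalLeftAction C D] [IsClosedLeft C D]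

variable (C) in
/-- Postcomposition with an endomorphism of `M` on the internal End of `M`. -/
noncomputable def leftEndMap {M : D} (e : M ⟶ M) : leftEnd C M ⟶ leftEnd C M :=
  (leftHom C M).map e

theorem leftEndMap_ev {M : D} (e : M ⟶ M) :
    leftEndMap C e ⊵ₗ M ≫ leftEndEv C M = leftEndEv C M ≫ e :=
  (leftHomAdj C M).counit.naturality e

/-- Associativity of composition, `e ∘ (f ∘ g) = (e ∘ f) ∘ g`: postcomposition commutes with right
multiplication, which is why the regular right module appears. -/
theorem leftEndMul_map {M : D} (e : M ⟶ M) :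
    leftEndMul C M ≫ leftEndMap C e = leftEndMap C e ▷ leftEnd C M ≫ leftEndMul C M := by
  apply leftEnd_ext
  rw [comp_actionHomLeft, Category.assoc, leftEndMap_ev, reassoc_of% leftEndMul_ev (C := C) M,
    comp_actionHomLeft, Category.assoc, leftEndMul_ev, whiskerRight_actionHomLeft,
    Category.assoc, Category.assoc, Iso.inv_hom_id_assoc, ← action_exchange_assoc, leftEndMap_ev]

/-- Evaluating at the unit of `End(M)` recovers `e`. -/
theorem leftEndMap_injective {M : D} {e e' : M ⟶ M}
    (h : leftEndMap C e = leftEndMap C e') : e = e' := by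
  have h2 : leftEndEv C M ≫ e = leftEndEv C M ≫ e' := by
    rw [← leftEndMap_ev, h, leftEndMap_ev]
  rw [← cancel_epi (λₗ M : 𝟙_ C ⊙ₗ M ≅ M).hom, ← leftEndOne_ev, Category.assoc, Category.assoc, h2]

variable (C) in
/-- Postcomposition with an endomorphism of `M`, as an endomorphism of the regular right module
of the internal End of `M`. -/
noncomputable def leftEndPostcomp {M : D} (e : M ⟶ M) :
    RightMod.regular (leftEnd C M) ⟶ RightMod.regular (leftEnd C M) where
  hom := leftEndMap C e
  act_hom := leftEndMul_map e

theorem leftEndPostcomp_comp {M : D} (e e' : M ⟶ M) :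
    leftEndPostcomp C e ≫ leftEndPostcomp C e' = leftEndPostcomp C (e ≫ e') :=
  RightMod.hom_ext _ _ ((leftHom C M).map_comp e e').symm

theorem leftEndPostcomp_id (M : D) : leftEndPostcomp C (𝟙 M) = 𝟙 _ :=
  RightMod.hom_ext _ _ ((leftHom C M).map_id M)

theorem leftEndPostcomp_injective {M : D} {e e' : M ⟶ M}
    (h : leftEndPostcomp C e = leftEndPostcomp C e') : e = e' :=
  leftEndMap_injective (congrArg RightMod.Hom.hom h)

/-- A section of `X ▷ M ⟶ End(M) ▷ M ⟶ M`, where `X` is a right ideal of `End(M)`, yields a lift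
of the unit of `End(M)` to `X`. -/
theorem exists_unit_of_section_left {M : D} {X : C} [HasRightDual X]
    {a : X ⊗ leftEnd C M ⟶ X} {j : X ⟶ leftEnd C M}
    (hj : a ≫ j = j ▷ leftEnd C M ≫ leftEndMul C M) {s : M ⟶ X ⊙ₗ M}
    (hs : s ≫ j ⊵ₗ M ≫ leftEndEv C M = 𝟙 M) : ∃ u : 𝟙_ C ⟶ X, u ≫ j = leftEndOne C M := by
  -- In elements, if `s(m) = ∑ xₖ ⊗ mₖ`, then `t(ξ)(m) = ∑ ξ(xₖ) mₖ`.
  let t : Xᘁ ⟶ leftEnd C M :=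
    leftCurry (Xᘁ ⊴ₗ s ≫ (αₗ Xᘁ X M).inv ≫ ε_ X Xᘁ ⊵ₗ M ≫ (λₗ M).hom)
  have ht : t ⊵ₗ M ≫ leftEndEv C M =
      Xᘁ ⊴ₗ s ≫ (αₗ Xᘁ X M).inv ≫ ε_ X Xᘁ ⊵ₗ M ≫ (λₗ M).hom := leftCurry_ev _
  have ht' := congrArg (fun f => X ⊴ₗ f) ht
  simp only [actionHomRight_comp] at ht'
  -- For dual bases `eᵢ`, `eⁱ` of `X`, this is `u = ∑ eᵢ · t(eⁱ)`. By `hj` and the zigzag identity,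
  -- `j(u)(m) = ∑ j(eᵢ)(t(eⁱ)(m))` is the evaluation of `j` on `s(m)`, which is `m` by `hs`.
  refine ⟨η_ X Xᘁ ≫ X ◁ t ≫ a, leftEnd_ext ?_⟩
  rw [Category.assoc, Category.assoc, hj]
  simp only [comp_actionHomLeft, Category.assoc, leftEndMul_ev, leftEndOne_ev]
  rw [whiskerRight_actionHomLeft, whiskerLeft_actionHomLeft]
  simp only [Category.assoc, Iso.inv_hom_id_assoc]
  -- This lets `s` slide past the coevaluation, which then meets the evaluation contained in `t`.
  have h : (αₗ X Xᘁ M).hom ≫ X ⊴ₗ Xᘁ ⊴ₗ s = (X ⊗ Xᘁ) ⊴ₗ s ≫ (αₗ X Xᘁ (X ⊙ₗ M)).hom := by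
    rw [tensor_actionHomRight, Category.assoc, Category.assoc, Iso.inv_hom_id, Category.comp_id]
  rw [← action_exchange_assoc, reassoc_of% ht', reassoc_of% h, ← action_exchange_assoc,
    reassoc_of% coevaluation_evaluation_action X Xᘁ M, ← actionUnitIso_hom_naturality_assoc, hs,
    Category.comp_id]

end InternalEndLeft

/-! ### Internal Ends in right module categories -/

section InternalEndRight

open MonoidalRightAction

variable {C : Type u} [Category.{v} C] [MonoidalCategory C]
  {D : Type u₂} [Category.{v₂} D] [MonoidalRightAction C D] [IsClosedRight C D]

variable (C) in
/-- Postcomposition with an endomorphism of `N` on the internal End of `N`. -/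
noncomputable def rightEndMap {N : D} (e : N ⟶ N) : rightEnd C N ⟶ rightEnd C N :=
  (rightHom C N).map e

theorem rightEndMap_ev {N : D} (e : N ⟶ N) :
    N ⊴ᵣ rightEndMap C e ≫ rightEndEv C N = rightEndEv C N ≫ e :=
  (rightHomAdj C N).counit.naturality e

/-- Here the first factor of a product acts first, so postcomposition commutes with left
multiplication and the regular left module appears. -/
theorem rightEndMul_map {N : D} (e : N ⟶ N) :
    rightEndMul C N ≫ rightEndMap C e = rightEnd C N ◁ rightEndMap C e ≫ rightEndMul C N := by
  apply rightEnd_ext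
  rw [actionHomRight_comp, Category.assoc, rightEndMap_ev, reassoc_of% rightEndMul_ev (C := C) N,
    actionHomRight_comp, Category.assoc, rightEndMul_ev, whiskerRight_actionHomLeft,
    Category.assoc, Category.assoc, Iso.inv_hom_id_assoc, action_exchange_assoc, rightEndMap_ev]

theorem rightEndMap_injective {N : D} {e e' : N ⟶ N}
    (h : rightEndMap C e = rightEndMap C e') : e = e' := by
  have h2 : rightEndEv C N ≫ e = rightEndEv C N ≫ e' := by
    rw [← rightEndMap_ev, h, rightEndMap_ev]
  rw [← cancel_epi (ρᵣ N : N ⊙ᵣ 𝟙_ C ≅ N).hom, ← rightEndOne_ev, Category.assoc, Category.assoc,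
    h2]

variable (C) in
/-- Postcomposition with an endomorphism of `N`, as an endomorphism of the regular left module
of the internal End of `N`. -/
noncomputable def rightEndPostcomp {N : D} (e : N ⟶ N) :
    Mod.regular (rightEnd C N) ⟶ Mod.regular (rightEnd C N) :=
  LeftMod.mkHom (M := Mod.regular (rightEnd C N)) (N := Mod.regular (rightEnd C N))
    (rightEndMap C e) (rightEndMul_map e)

theorem rightEndPostcomp_comp {N : D} (e e' : N ⟶ N) :
    rightEndPostcomp C e ≫ rightEndPostcomp C e' = rightEndPostcomp C (e ≫ e') :=
  Mod.hom_ext _ _ ((rightHom C N).map_comp e e').symm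

theorem rightEndPostcomp_id (N : D) : rightEndPostcomp C (𝟙 N) = 𝟙 _ :=
  Mod.hom_ext _ _ ((rightHom C N).map_id N)

theorem rightEndPostcomp_injective {N : D} {e e' : N ⟶ N}
    (h : rightEndPostcomp C e = rightEndPostcomp C e') : e = e' :=
  rightEndMap_injective (congrArg Mod.Hom.hom h)

/-- A section of `N ◁ X ⟶ N ◁ End(N) ⟶ N`, where `X` is a left ideal of `End(N)`, yields a lift
of the unit of `End(N)` to `X`. -/
theorem exists_unit_of_section_right {N : D} {X : C} [HasLeftDual X]
    {a : rightEnd C N ⊗ X ⟶ X} {j : X ⟶ rightEnd C N}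
    (hj : a ≫ j = rightEnd C N ◁ j ≫ rightEndMul C N) {s : N ⟶ N ⊙ᵣ X}
    (hs : s ≫ N ⊴ᵣ j ≫ rightEndEv C N = 𝟙 N) : ∃ u : 𝟙_ C ⟶ X, u ≫ j = rightEndOne C N := by
  let t : (ᘁX) ⟶ rightEnd C N :=
    rightCurry (s ⊵ᵣ (ᘁX) ≫ (αᵣ N X (ᘁX)).inv ≫ N ⊴ᵣ ε_ (ᘁX) X ≫ (ρᵣ N).hom)
  have ht : N ⊴ᵣ t ≫ rightEndEv C N =
      s ⊵ᵣ (ᘁX) ≫ (αᵣ N X (ᘁX)).inv ≫ N ⊴ᵣ ε_ (ᘁX) X ≫ (ρᵣ N).hom := rightCurry_ev _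
  have ht' := congrArg (fun f => f ⊵ᵣ X) ht
  simp only [comp_actionHomLeft] at ht'
  -- The left dual places `t` to the left of `X`, where the left ideal absorbs it: `u = ∑ t(eⁱ) ·
  -- eᵢ`.
  refine ⟨η_ (ᘁX) X ≫ t ▷ X ≫ a, rightEnd_ext ?_⟩
  rw [Category.assoc, Category.assoc, hj]
  simp only [actionHomRight_comp, Category.assoc, rightEndMul_ev, rightEndOne_ev]
  rw [whiskerRight_actionHomLeft, actionHomRight_whiskerRight]
  simp only [Category.assoc, Iso.inv_hom_id_assoc]
  have h : (αᵣ N (ᘁX) X).hom ≫ (s ⊵ᵣ (ᘁX)) ⊵ᵣ X =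
      s ⊵ᵣ ((ᘁX) ⊗ X) ≫ (αᵣ (N ⊙ᵣ X) (ᘁX) X).hom := by
    rw [actionHomLeft_tensor, Category.assoc, Category.assoc, Iso.inv_hom_id, Category.comp_id]
  rw [action_exchange_assoc, reassoc_of% ht', reassoc_of% h, action_exchange_assoc,
    reassoc_of% action_coevaluation_evaluation (ᘁX) X N, ← actionUnitIso_hom_naturality_assoc, hs,
    Category.comp_id]

end InternalEndRight

/-! ### Simplistic internal Ends -/

section Main

variable {C : Type u} [Category.{v} C] [Abelian C] [MonoidalCategory C] [MonoidalPreadditive C]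
  [RigidCategory C] {A : C} [MonObj A]

theorem IsRightSimplistic.simple (hD : IsSemisimpleCat (RightMod A)) {M : RightMod A}
    (h : IsRightSimplistic (leftEnd C M)) : Simple M := by
  have hs := h.2
  refine hD.simple_of_idempotents (fun h0 => ?_) (fun e he => ?_)
  · apply id_nonzero (RightMod.regular (leftEnd C M))
    -- If `M` is zero, evaluation vanishes, so any two maps into `End(M)` agree and the regular
    -- module is zero.
    have hev : leftEndEv C M = 0 := by rw [← Category.comp_id (leftEndEv C M), h0, comp_zero]
    refine RightMod.hom_ext _ _ (leftEnd_ext ?_)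
    rw [hev, comp_zero, comp_zero]
  · by_cases h0 : leftEndPostcomp C e = 0
    · left
      apply leftEndPostcomp_injective (C := C)
      -- Postcomposition with `0` vanishes because it equals postcomposition with `e ≫ 0`, which
      -- factors through that with `e`; its additivity is not needed.
      rw [h0, ← zero_comp (f := leftEndPostcomp C (0 : M ⟶ M)), ← h0, leftEndPostcomp_comp,
        comp_zero]
    · right
      have := RightMod.isIso_of_simple _ hs hs h0
      apply leftEndPostcomp_injective (C := C)
      -- An invertible idempotent is the identity.
      rw [← cancel_epi (leftEndPostcomp C e), leftEndPostcomp_comp, he, leftEndPostcomp_id,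
        Category.comp_id]

theorem isRightSimplistic_leftEnd (hD : IsSemisimpleCat (RightMod A)) {M : RightMod A}
    (hM : Simple M) : IsRightSimplistic (leftEnd C M) := by
  -- If `End(M)` were zero, postcomposition with `𝟙 M` and with `0` would agree, forcing `𝟙 M = 0`.
  have h1 : 𝟙 (leftEnd C M) ≠ 0 := fun h0 => id_nonzero M <| by
    apply leftEndMap_injective (C := C)
    rw [← Category.comp_id (leftEndMap C (𝟙 M)), h0, comp_zero,
      ← Category.comp_id (leftEndMap C 0), h0, comp_zero]
  refine ⟨fun hz => h1 (hz.eq_of_src _ _), ⟨fun {I} i hi => ⟨fun hiso h0 => h1 ?_, fun h0 => ?_⟩⟩⟩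
  · have h : 𝟙 (RightMod.regular (leftEnd C M)) = 0 := by
      rw [← IsIso.inv_hom_id i]; nth_rw 2 [h0]; rw [comp_zero]
    exact congrArg RightMod.Hom.hom h
  · have hp : MonoidalLeftAction.actionHomLeft i.hom M ≫ leftEndEv C M ≠ 0 := fun h => by
      apply h0
      refine RightMod.hom_ext _ _ (leftEnd_ext (h.trans ?_))
      refine RightMod.hom_ext _ _ ?_
      -- The goal with the action and the zero morphism unfolded to `C`; `f` stands for the map
      -- underlying the evaluation.
      have h' (f : leftEnd C M ⊗ M.X ⟶ M.X) : 0 = (0 : I.X ⟶ leftEnd C M) ▷ M.X ≫ f := by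
        rw [MonoidalPreadditive.zero_whiskerRight, zero_comp]
      exact h' _
    obtain ⟨s, hs⟩ := hD.exists_section RightMod.isIso_of_simple hM hp
    obtain ⟨u, hu⟩ := exists_unit_of_section_left i.act_hom hs
    exact RightMod.isIso_of_unit i u hu

theorem IsLeftSimplistic.simple (hD : IsSemisimpleCat (Mod C A)) {N : Mod C A}
    (h : IsLeftSimplistic (rightEnd C N)) : Simple N := by
  have hs := h.2
  refine hD.simple_of_idempotents (fun h0 => ?_) (fun e he => ?_)
  · apply id_nonzero (Mod.regular (rightEnd C N))
    have hev : rightEndEv C N = 0 := by rw [← Category.comp_id (rightEndEv C N), h0, comp_zero]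
    refine Mod.hom_ext _ _ (rightEnd_ext ?_)
    rw [hev, comp_zero, comp_zero]
  · by_cases h0 : rightEndPostcomp C e = 0
    · left
      apply rightEndPostcomp_injective (C := C)
      rw [h0, ← zero_comp (f := rightEndPostcomp C (0 : N ⟶ N)), ← h0, rightEndPostcomp_comp,
        comp_zero]
    · right
      have := LeftMod.isIso_of_simple _ hs hs h0
      apply rightEndPostcomp_injective (C := C)
      rw [← cancel_epi (rightEndPostcomp C e), rightEndPostcomp_comp, he, rightEndPostcomp_id,
        Category.comp_id]

theorem isLeftSimplistic_rightEnd (hD : IsSemisimpleCat (Mod C A)) {N : Mod C A}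
    (hN : Simple N) : IsLeftSimplistic (rightEnd C N) := by
  have h1 : 𝟙 (rightEnd C N) ≠ 0 := fun h0 => id_nonzero N <| by
    apply rightEndMap_injective (C := C)
    rw [← Category.comp_id (rightEndMap C (𝟙 N)), h0, comp_zero,
      ← Category.comp_id (rightEndMap C 0), h0, comp_zero]
  refine ⟨fun hz => h1 (hz.eq_of_src _ _), ⟨fun {I} i hi => ⟨fun hiso h0 => h1 ?_, fun h0 => ?_⟩⟩⟩
  · have h : 𝟙 (Mod.regular (rightEnd C N)) = 0 := by
      rw [← IsIso.inv_hom_id i]; nth_rw 2 [h0]; rw [comp_zero]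
    exact congrArg Mod.Hom.hom h
  · have hp : MonoidalRightAction.actionHomRight N i.hom ≫ rightEndEv C N ≠ 0 := fun h => by
      apply h0
      refine Mod.hom_ext _ _ (rightEnd_ext (h.trans ?_))
      refine Mod.hom_ext _ _ ?_
      have h' (f : N.X ⊗ rightEnd C N ⟶ N.X) : 0 = N.X ◁ (0 : I.X ⟶ rightEnd C N) ≫ f := by
        rw [MonoidalPreadditive.whiskerLeft_zero, zero_comp]
      exact h' _
    obtain ⟨s, hs⟩ := hD.exists_section LeftMod.isIso_of_simple hN hp
    obtain ⟨u, hu⟩ := exists_unit_of_section_right (LeftMod.hom_act i) hs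
    exact LeftMod.isIso_of_unit i u hu

end Main

end DivAlg

theorem mainTheorem3 {k : Type w} [Field k] [IsAlgClosed k] [CharZero k]
    {C : Type u} [Category.{v} C] [Abelian C] [Linear k C] [MonoidalCategory C]
    [MonoidalPreadditive C] [MonoidalLinear k C] [RigidCategory C] [DivAlg.IsMultifusion k C]
    (A : C) [MonObj A] :
    (DivAlg.OstrikLeft C (DivAlg.RightMod A) →
      ∀ M : DivAlg.RightMod A, DivAlg.IsRightSimplistic (DivAlg.leftEnd C M) ↔ Simple M) ∧
    (DivAlg.OstrikRight C (Mod C A) →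
      ∀ N : Mod C A, DivAlg.IsLeftSimplistic (DivAlg.rightEnd C N) ↔ Simple N) :=
  ⟨fun h _ => ⟨fun hE => hE.simple h.semisimple,
      fun hM => DivAlg.isRightSimplistic_leftEnd h.semisimple hM⟩,
    fun h _ => ⟨fun hE => hE.simple h.semisimple,
      fun hN => DivAlg.isLeftSimplistic_rightEnd h.semisimple hN⟩⟩
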